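/- Let $\mathbb O$ be the octonions with standard basis $e_0=1,e_1,\dots,e_7$. A (unital) $\mathbb O$-bimodule is a real vector space $M$ with real-bilinear left and right multiplications by octonions such that $1x=x=x1$ and $[p,q,x]=[q,x,p]=[x,p,q]=-[q,p,x]$ for all $p,q\in\mathbb O$, $x\in M$, where $[a,b,c]=(ab)c-a(bc)$. Put $\operatorname{Re}M=\{m\in M:[p,q,m]=0\ \forall p,q\in\mathbb O\}$, with the real part operator $\operatorname{Re}m=\frac5{12}m-\frac1{12}\sum_{i=1}^7e_ime_i$. A real-linear map $f:M\to M'$ between $\mathbb O$-bimodules is right para-linear if $\operatorname{Re}B_p(f,x)=0$ for all $p\in\mathbb O$, $x\in M$, where $B_p(f,x)=f(x)p-f(xp)$. A Hilbert $\mathbb O$-bimodule is an $\mathbb O$-bimodule $H$ with a real-bilinear map $\langle\cdot,\cdot\rangle:H\times H\to\mathbb O$ such that each $\langle u,\cdot\rangle$ is right para-linear, $\langle u,v\rangle=\overline{\langle v,u\rangle}$, $\langle u,u\rangle$ is a nonnegative real that vanishes only for $u=0$, and $H$ is complete for $\|u\|=\sqrt{\langle u,u\rangle}$. The slice cone is $\mathbb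 C(H)=\bigcup_J(\operatorname{Re}H+J\operatorname{Re}H)$, $J$ running over the imaginary octonions with $|J|=1$. Write $B_p(u,v)=\langle u,v\rangle p-\langle u,vp\rangle$. A family $(x_\alpha)$ in $H$ is orthonormal if $\langle x_\alpha,x_\beta\rangle=\delta_{\alpha\beta}$, weak associative orthonormal if moreover $B_p(x_\alpha,x_\beta)=0$ for all $p,\alpha,\beta$, and a weak associative orthonormal basis if it is maximal among weak associative orthonormal families. Let $T:H\to H$ be bounded and real-linear. Its adjoint $T^*$ is determined by the condition that, for every $y\in H$, $\langle T^*y,\cdot\rangle$ is the unique right para-linear map with $\operatorname{Re}\langle T^*y,x\rangle=\operatorname{Re}\langle y,Tx\rangle$ for all $x\in H$; $T$ is self-adjoint if $T=T^*$. For $\lambda\in\mathbb O$ let $E_\lambda(T)=\{x\in H:Tx=x\lambda\}$; $\lambda$ is an eigenvalue if $E_\lambda(T)\ne\{0\}$. A strong eigenvector for $\lambda$ is a nonzero $z\in\mathbb C(H)$ with $Tz=z\lambda$. The number $\lambda$ is a standard strong eigenvalue if it has a strong eigenvector and there is an orthonormal system $\{z_i\}$ of strong eigenvectors for $\lambda$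 such that $E_\lambda(T)$ is contained in the closure of the set of finite sums $\sum_k z_{i_k}p_k$, $p_k\in\mathbb O$. Theorem (Hilbert-Schmidt). Let $H$ be a Hilbert $\mathbb O$-bimodule and let $T:H\to H$ be a bounded, compact, self-adjoint, right para-linear operator such that every real eigenvalue of $T$ is a standard strong eigenvalue. Then $H$ has a weak associative orthonormal basis $\{z_i\}_{i\in\mathcal N}\cup\{z_\alpha\}_{\alpha\in\Lambda}$ of strong eigenvectors of $T$ (so all of them lie in $\mathbb C(H)$) such that: 1. $\mathcal N$ is finite or countable, $Tz_i=\lambda_iz_i$ with $\lambda_i\in\mathbb R\setminus\{0\}$ for $i\in\mathcal N$, and $\lambda_i\to0$ if $\mathcal N$ is infinite; 2. $Tz_\alpha=0$ for $\alpha\in\Lambda$; 3. each $P_{z_i}(x)=z_i\langle z_i,x\rangle$ is a right para-linear map with $P_{z_i}(P_{z_i}x)=P_{z_i}x$, and for every $x\in H$ $$Tx=\sum_{i\in\mathcal N}\lambda_iP_{z_i}x,$$ where the series converges (unconditionally) in the norm of $H$. -/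

import Mathlib

open Filter Topology

universe u

/-- The octonions, as real coordinate vectors with respect to the standard basis
`1 = e₀, e₁, …, e₇`. The multiplication (defined below) is *not* the pointwise one. -/
def Octonion : Type := Fin 8 → ℝ

namespace Octonion

noncomputable instance : AddCommGroup Octonion := inferInstanceAs (AddCommGroup (Fin 8 → ℝ))

noncomputable instance : Module ℝ Octonion := inferInstanceAs (Module ℝ (Fin 8 → ℝ))

@[ext] theorem ext {x y : Octonion} (h : ∀ i : Fin 8, x i = y i) : x = y := funext h

@[simp] theorem zero_apply (i : Fin 8) : (0 : Octonion) i = 0 := rfl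
@[simp] theorem add_apply (x y : Octonion) (i : Fin 8) : (x + y) i = x i + y i := rfl
@[simp] theorem neg_apply (x : Octonion) (i : Fin 8) : (-x) i = -(x i) := rfl
@[simp] theorem sub_apply (x y : Octonion) (i : Fin 8) : (x - y) i = x i - y i := rfl
@[simp] theorem smul_apply (r : ℝ) (x : Octonion) (i : Fin 8) : (r • x) i = r * x i := rfl

/-- The standard basis vectors `e₀ = 1, e₁, …, e₇`. -/
def e (k : Fin 8) : Octonion := fun i => if i = k then 1 else 0

noncomputable instance : One Octonion := ⟨e 0⟩

/-- The bilinear multiplication with unit `e₀`, `eᵢ eᵢ = -1`, and `eᵢ eⱼ = eₖ = - eⱼ eᵢ` for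
`(i, j, k)` a cyclic rotation of one of the oriented triples
`(123), (145), (176), (246), (257), (347), (365)` of the Fano plane. -/
noncomputable instance : Mul Octonion where
  mul x y :=
   ![
     x 0 * y 0 - x 1 * y 1 - x 2 * y 2 - x 3 * y 3 - x 4 * y 4 - x 5 * y 5 - x 6 * y 6 - x 7 * y 7,
     x 0 * y 1 + x 1 * y 0 + x 2 * y 3 - x 3 * y 2 + x 4 * y 5 - x 5 * y 4 - x 6 * y 7 + x 7 * y 6,
     x 0 * y 2 - x 1 * y 3 + x 2 * y 0 + x 3 * y 1 + x 4 * y 6 + x 5 * y 7 - x 6 * y 4 - x 7 * y 5,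
     x 0 * y 3 + x 1 * y 2 - x 2 * y 1 + x 3 * y 0 + x 4 * y 7 - x 5 * y 6 + x 6 * y 5 - x 7 * y 4,
     x 0 * y 4 - x 1 * y 5 - x 2 * y 6 - x 3 * y 7 + x 4 * y 0 + x 5 * y 1 + x 6 * y 2 + x 7 * y 3,
     x 0 * y 5 + x 1 * y 4 - x 2 * y 7 + x 3 * y 6 - x 4 * y 1 + x 5 * y 0 - x 6 * y 3 + x 7 * y 2,
     x 0 * y 6 + x 1 * y 7 + x 2 * y 4 - x 3 * y 5 - x 4 * y 2 + x 5 * y 3 + x 6 * y 0 - x 7 * y 1,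
     x 0 * y 7 - x 1 * y 6 + x 2 * y 5 + x 3 * y 4 - x 4 * y 3 - x 5 * y 2 + x 6 * y 1 + x 7 * y 0]

/-- Conjugation `x₀ + ∑ xᵢ eᵢ ↦ x₀ - ∑ xᵢ eᵢ`. -/
def conj (x : Octonion) : Octonion := fun i => if i = 0 then x i else -(x i)

/-- `J` is an imaginary unit: `J ∈ Im 𝕆` and `|J|² = J * conj J = 1`. -/
def IsImagUnit (J : Octonion) : Prop := J 0 = 0 ∧ J * conj J = 1

theorem mul_apply0 (x y : Octonion) : (x * y) 0 =
    x 0 * y 0 - x 1 * y 1 - x 2 * y 2 - x 3 * y 3 - x 4 * y 4 - x 5 * y 5 - x 6 * y 6 - x 7 * y 7 := rfl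
theorem mul_apply1 (x y : Octonion) : (x * y) 1 =
    x 0 * y 1 + x 1 * y 0 + x 2 * y 3 - x 3 * y 2 + x 4 * y 5 - x 5 * y 4 - x 6 * y 7 + x 7 * y 6 := rfl
theorem mul_apply2 (x y : Octonion) : (x * y) 2 =
    x 0 * y 2 - x 1 * y 3 + x 2 * y 0 + x 3 * y 1 + x 4 * y 6 + x 5 * y 7 - x 6 * y 4 - x 7 * y 5 := rfl
theorem mul_apply3 (x y : Octonion) : (x * y) 3 =
    x 0 * y 3 + x 1 * y 2 - x 2 * y 1 + x 3 * y 0 + x 4 * y 7 - x 5 * y 6 + x 6 * y 5 - x 7 * y 4 := rfl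
theorem mul_apply4 (x y : Octonion) : (x * y) 4 =
    x 0 * y 4 - x 1 * y 5 - x 2 * y 6 - x 3 * y 7 + x 4 * y 0 + x 5 * y 1 + x 6 * y 2 + x 7 * y 3 := rfl
theorem mul_apply5 (x y : Octonion) : (x * y) 5 =
    x 0 * y 5 + x 1 * y 4 - x 2 * y 7 + x 3 * y 6 - x 4 * y 1 + x 5 * y 0 - x 6 * y 3 + x 7 * y 2 := rfl
theorem mul_apply6 (x y : Octonion) : (x * y) 6 =
    x 0 * y 6 + x 1 * y 7 + x 2 * y 4 - x 3 * y 5 - x 4 * y 2 + x 5 * y 3 + x 6 * y 0 - x 7 * y 1 := rfl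
theorem mul_apply7 (x y : Octonion) : (x * y) 7 =
    x 0 * y 7 - x 1 * y 6 + x 2 * y 5 + x 3 * y 4 - x 4 * y 3 - x 5 * y 2 + x 6 * y 1 + x 7 * y 0 := rfl

theorem one_apply (i : Fin 8) : (1 : Octonion) i = if i = 0 then 1 else 0 := rfl

theorem ext8 {x y : Octonion} (h0 : x 0 = y 0) (h1 : x 1 = y 1) (h2 : x 2 = y 2) (h3 : x 3 = y 3)
    (h4 : x 4 = y 4) (h5 : x 5 = y 5) (h6 : x 6 = y 6) (h7 : x 7 = y 7) : x = y := by
  ext i; fin_cases i <;> assumption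

theorem assoc_cycl (x y z : Octonion) :
    x * y * z - x * (y * z) = y * z * x - y * (z * x) := by
  apply ext8 <;> simp only [mul_apply0, mul_apply1, mul_apply2, mul_apply3, mul_apply4, mul_apply5, mul_apply6, mul_apply7, sub_apply] <;> ring

theorem assoc_swap (x y z : Octonion) :
    x * y * z - x * (y * z) = -(y * x * z - y * (x * z)) := by
  apply ext8 <;> simp only [mul_apply0, mul_apply1, mul_apply2, mul_apply3, mul_apply4, mul_apply5, mul_apply6, mul_apply7, sub_apply, neg_apply] <;> ring

theorem one_mul' (x : Octonion) : 1 * x = x := by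
  apply ext8 <;> simp [mul_apply0, mul_apply1, mul_apply2, mul_apply3, mul_apply4, mul_apply5, mul_apply6, mul_apply7, one_apply]

theorem mul_one' (x : Octonion) : x * 1 = x := by
  apply ext8 <;> simp [mul_apply0, mul_apply1, mul_apply2, mul_apply3, mul_apply4, mul_apply5, mul_apply6, mul_apply7, one_apply]

/-- Multiplication as a real bilinear map. -/
noncomputable def mulBilin : Octonion →ₗ[ℝ] Octonion →ₗ[ℝ] Octonion :=
  LinearMap.mk₂ ℝ (fun x y => x * y)
    (by intros; apply ext8 <;> simp only [mul_apply0, mul_apply1, mul_apply2, mul_apply3, mul_apply4, mul_apply5, mul_apply6, mul_apply7, add_apply] <;> ring)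
    (by intros; apply ext8 <;> simp only [mul_apply0, mul_apply1, mul_apply2, mul_apply3, mul_apply4, mul_apply5, mul_apply6, mul_apply7, smul_apply] <;> ring)
    (by intros; apply ext8 <;> simp only [mul_apply0, mul_apply1, mul_apply2, mul_apply3, mul_apply4, mul_apply5, mul_apply6, mul_apply7, add_apply] <;> ring)
    (by intros; apply ext8 <;> simp only [mul_apply0, mul_apply1, mul_apply2, mul_apply3, mul_apply4, mul_apply5, mul_apply6, mul_apply7, smul_apply] <;> ring)

end Octonion

/-- A (unital) `𝕆`-bimodule: a real vector space with real-bilinear left and right octonionic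
multiplications, whose associators satisfy `[p,q,x] = [q,x,p] = [x,p,q] = -[q,p,x]`, where
`[a,b,c] = (ab)c - a(bc)`. -/
class OctonionBimodule (M : Type u) [AddCommGroup M] [Module ℝ M] where
  /-- left multiplication, `lmul p x = p x` -/
  lmul : Octonion →ₗ[ℝ] M →ₗ[ℝ] M
  /-- right multiplication, `rmul x p = x p` -/
  rmul : M →ₗ[ℝ] Octonion →ₗ[ℝ] M
  one_lmul : ∀ x : M, lmul 1 x = x
  rmul_one : ∀ x : M, rmul x 1 = x
  assoc_left_mid : ∀ (p q : Octonion) (x : M),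
    lmul (p * q) x - lmul p (lmul q x) = rmul (lmul q x) p - lmul q (rmul x p)
  assoc_mid_right : ∀ (p q : Octonion) (x : M),
    rmul (lmul q x) p - lmul q (rmul x p) = rmul (rmul x p) q - rmul x (p * q)
  assoc_right_left : ∀ (p q : Octonion) (x : M),
    rmul (rmul x p) q - rmul x (p * q) = -(lmul (q * p) x - lmul q (lmul p x))

open OctonionBimodule

/-- The regular bimodule: `𝕆` acting on itself by multiplication. -/
noncomputable instance Octonion.instOctonionBimodule : OctonionBimodule Octonion where
  lmul := Octonion.mulBilin
  rmul := Octonion.mulBilin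
  one_lmul x := Octonion.one_mul' x
  rmul_one x := Octonion.mul_one' x
  assoc_left_mid p q x := Octonion.assoc_cycl p q x
  assoc_mid_right p q x := Octonion.assoc_cycl q x p
  assoc_right_left p q x := (Octonion.assoc_cycl x p q).trans (Octonion.assoc_swap p q x)

section Bimodule

variable {M M' M'' : Type*} [AddCommGroup M] [Module ℝ M] [OctonionBimodule M]
  [AddCommGroup M'] [Module ℝ M'] [OctonionBimodule M']
  [AddCommGroup M''] [Module ℝ M''] [OctonionBimodule M'']

/-- `m ∈ Re M`, i.e. `[p,q,m] = 0` for all octonions `p, q`. -/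
def IsRealVec (m : M) : Prop := ∀ p q : Octonion, lmul (p * q) m - lmul p (lmul q m) = 0

/-- The real part operator `Re m = (5/12) m - (1/12) ∑_{i=1}^7 eᵢ m eᵢ` of an `𝕆`-bimodule. -/
noncomputable def rePart (m : M) : M :=
  (5 / 12 : ℝ) • m -
    (1 / 12 : ℝ) • ∑ i : Fin 7, rmul (lmul (Octonion.e i.succ) m) (Octonion.e i.succ)

/-- The second right associator `B_p(f, x) = f(x) p - f(x p)`. -/
noncomputable def secondAssoc (p : Octonion) (f : M →ₗ[ℝ] M') (x : M) : M' :=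
  rmul (f x) p - f (rmul x p)

/-- Right para-linearity of a real-linear map: `Re B_p(f, x) = 0`. -/
def IsParaLinear (f : M →ₗ[ℝ] M') : Prop :=
  ∀ (p : Octonion) (x : M), rePart (secondAssoc p f x) = 0

/-- `h` is the regular composition of `f` and `g`: the (unique) right para-linear map such that
`Re (h x) = Re (f (g x))` for all `x`. -/
def IsRegularComposition (f : M' →ₗ[ℝ] M'') (g : M →ₗ[ℝ] M') (h : M →ₗ[ℝ] M'') : Prop :=
  IsParaLinear h ∧ ∀ x : M, rePart (h x) = rePart (f (g x))

/-- The slice cone `ℂ(M) = ⋃_J (Re M + J Re M)`, `J` running over the imaginary units. -/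
def sliceCone (M : Type*) [AddCommGroup M] [Module ℝ M] [OctonionBimodule M] : Set M :=
  {z | ∃ J : Octonion, J.IsImagUnit ∧
    ∃ a b : M, IsRealVec a ∧ IsRealVec b ∧ z = a + lmul J b}

/-- The set of all finite sums `∑ z_k p_k` with `z_k ∈ s` and octonions `p_k`. -/
def octonionSpan (s : Set M) : Set M :=
  {x | ∃ (N : ℕ) (z : Fin N → M) (p : Fin N → Octonion),
    (∀ k, z k ∈ s) ∧ x = ∑ k, rmul (z k) (p k)}

end Bimodule

/-- A Hilbert `𝕆`-bimodule: an `𝕆`-bimodule with an `𝕆`-valued inner product, complete for the norm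
`‖x‖ = √⟨x, x⟩`. By polarization, the real inner product of `H` is necessarily `Re ⟨x, y⟩`; the
field `oinner_self` says that `⟨x, x⟩` is real and equal to `‖x‖²`, hence contains positivity. -/
class HilbertOctonionBimodule (H : Type u) [NormedAddCommGroup H] [InnerProductSpace ℝ H]
    [CompleteSpace H] extends OctonionBimodule H where
  /-- the octonionic inner product `⟨x, y⟩` -/
  oinner : H →ₗ[ℝ] H →ₗ[ℝ] Octonion
  oinner_paraLinear : ∀ x : H, IsParaLinear (oinner x)
  oinner_conj : ∀ x y : H, oinner x y = (oinner y x).conj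
  oinner_self : ∀ x : H, oinner x x = (‖x‖ ^ 2 : ℝ) • (1 : Octonion)

open HilbertOctonionBimodule

section Hilbert

variable {H : Type u} [NormedAddCommGroup H] [InnerProductSpace ℝ H] [CompleteSpace H]
  [HilbertOctonionBimodule H]

/-- `S` is the adjoint `T^*` of `T`: for every `y`, the vector `S y` represents (in the sense of the
Riesz theorem) the regular composition of the functional `⟨y, ·⟩` with `T`. -/
def IsOctonionAdjoint (T S : H →L[ℝ] H) : Prop :=
  ∀ y : H, IsRegularComposition (oinner y) (T : H →ₗ[ℝ] H) (oinner (S y))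

/-- Self-adjointness, `T = T^*`. -/
def IsOctonionSelfAdjoint (T : H →L[ℝ] H) : Prop := IsOctonionAdjoint T T

/-- An orthonormal family: `⟨z_i, z_j⟩ = δ_ij`. -/
def IsOctonionOrthonormal {ι : Type*} (z : ι → H) : Prop :=
  (∀ i, oinner (z i) (z i) = 1) ∧ ∀ i j, i ≠ j → oinner (z i) (z j) = 0

/-- A weak associative orthonormal family: orthonormal, and
`B_p(z_i, z_j) = ⟨z_i, z_j⟩ p - ⟨z_i, z_j p⟩ = 0` for all octonions `p`. -/
def IsWeakAssocOrthonormal {ι : Type*} (z : ι → H) : Prop :=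
  IsOctonionOrthonormal z ∧
    ∀ (p : Octonion) (i j : ι), secondAssoc p (oinner (z i)) (z j) = 0

/-- A weak associative orthonormal basis: a maximal weak associative orthonormal family. -/
def IsWeakAssocOrthonormalBasis {ι : Type*} (z : ι → H) : Prop :=
  IsWeakAssocOrthonormal z ∧
    ∀ s : Set H, Set.range z ⊆ s → IsWeakAssocOrthonormal (fun x : s => (x : H)) →
      s = Set.range z

/-- The eigenspace `E_r(T) = {x | T x = x r}` for an octonion `r`. -/
def octonionEigenspace (T : H →L[ℝ] H) (r : Octonion) : Set H := {x | T x = rmul x r}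

/-- `r` is an eigenvalue of `T`: `E_r(T) ≠ 0`. -/
def IsOctonionEigenvalue (T : H →L[ℝ] H) (r : Octonion) : Prop :=
  ∃ x ∈ octonionEigenspace T r, x ≠ 0

/-- `z` is a strong eigenvector of `T` for `r`: a nonzero element of the slice cone
with `T z = z r`. -/
def IsStrongEigenvector (T : H →L[ℝ] H) (r : Octonion) (z : H) : Prop :=
  z ∈ sliceCone H ∧ z ≠ 0 ∧ T z = rmul z r

/-- `r` is a standard strong eigenvalue of `T`: it has a strong eigenvector, and `E_r(T)` is
contained in the closed `𝕆`-span of an orthonormal system of strong eigenvectors for `r`. (If the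
eigenspace lies in the algebraic span, this holds a fortiori; the two notions can only differ when
`E_r(T)` is infinite dimensional, which for a compact `T` and real `r` forces `r = 0`.) -/
def IsStandardStrongEigenvalue (T : H →L[ℝ] H) (r : Octonion) : Prop :=
  (∃ z, IsStrongEigenvector T r z) ∧
    ∃ s : Set H, IsOctonionOrthonormal (fun x : s => (x : H)) ∧
      (∀ z ∈ s, IsStrongEigenvector T r z) ∧
      octonionEigenspace T r ⊆ closure (octonionSpan s)

/-- The slice projection `P_z x = z ⟨z, x⟩`. -/
noncomputable def sliceProj (z : H) : H →ₗ[ℝ] H := (rmul z).comp (oinner z)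

end Hilbert

/-!
Write vectors of the slice cone as `z = a + b J` and `w = c + d K` with `a`, `b`, `c`, `d` real.
Since `⟨a p, b q⟩ = Re ⟨a, b⟩ (conj p) q` for real `a`, `b`, all octonionic products of such vectors
are explicit; in particular `B_p(z, w) = Re ⟨b, d⟩ [conj J, K, p]`, and this vanishes when
`⟨z, w⟩ = 0`, so that `⟨z, w⟩ = 0` implies `z 𝕆 ⟂ w 𝕆`.

A self-adjoint para-linear `T` satisfies `T (a p) = (T a) p` for real `a`, hence is complex linear
on the slice `z span {1, J}`. Strong eigenvectors `z`, `w` for different real eigenvalues therefore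
have orthogonal slices, which is enough to conclude `⟨z, w⟩ = 0`. By the standardness hypothesis,
`z 𝕆` is then orthogonal to all other eigenspaces of `T`, and the spectral theorem of the compact
symmetric real operator `T` forces `z 𝕆` into the eigenspace of `z`. Hence orthonormal systems of
strong eigenvectors for all the real eigenvalues combine to a total orthonormal family `v` such that
the vectors `(v i) e_k` form a Hilbert basis of real eigenvectors of `T`, and the theorem is the
expansion with respect to this basis, grouped by `i`.
-/

namespace Octonion

noncomputable scoped instance : NonAssocRing Octonion where
  zero_mul := LinearMap.map_zero₂ mulBilin
  mul_zero x := map_zero (mulBilin x)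
  left_distrib x := map_add (mulBilin x)
  right_distrib := LinearMap.map_add₂ mulBilin
  one_mul := one_mul'
  mul_one := mul_one'

scoped instance : IsScalarTower ℝ Octonion Octonion := ⟨LinearMap.map_smul₂ mulBilin⟩

scoped instance : SMulCommClass ℝ Octonion Octonion :=
  ⟨fun r x => (map_smul (mulBilin x) r ·|>.symm)⟩

theorem lmul_eq_mul (x y : Octonion) : lmul x y = x * y := rfl

theorem rmul_eq_mul (x y : Octonion) : rmul x y = x * y := rfl

@[simp] theorem one_apply_zero : (1 : Octonion) 0 = 1 := rfl

theorem associator_cycl (x y z : Octonion) : associator x y z = associator y z x :=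
  assoc_cycl x y z

theorem associator_swap (x y z : Octonion) : associator x y z = -associator y x z :=
  assoc_swap x y z

theorem associator_self_left (x y : Octonion) : associator x x y = 0 := by
  linear_combination (norm := module) (1 / 2 : ℝ) • associator_swap x x y

theorem associator_self_outer (x y : Octonion) : associator x y x = 0 := by
  rw [← associator_cycl, associator_self_left]

theorem associator_add_mid (x y z w : Octonion) :
    associator x (y + z) w = associator x y w + associator x z w := by
  simp only [associator_apply, mul_add, add_mul]
  abel

theorem associator_smul_mid (r : ℝ) (x y z : Octonion) :
    associator x (r • y) z = r • associator x y z := by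
  simp only [associator_apply, mul_smul_comm, smul_mul_assoc, smul_sub]

theorem associator_one_mid (x y : Octonion) : associator x 1 y = 0 := by
  rw [associator_apply, mul_one, one_mul, sub_self]

theorem mul_apply_zero_comm (x y : Octonion) : (x * y) 0 = (y * x) 0 := by
  simp only [mul_apply0]
  ring

theorem associator_apply_zero (x y z : Octonion) : associator x y z 0 = 0 := by
  simp only [associator_apply, sub_apply, mul_apply0, mul_apply1, mul_apply2, mul_apply3,
    mul_apply4, mul_apply5, mul_apply6, mul_apply7]
  ring

theorem mul_mul_apply_zero (x y z : Octonion) : (x * y * z) 0 = (x * (y * z)) 0 :=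
  sub_eq_zero.1 (associator_apply_zero x y z)

theorem eq_sum_smul_e (x : Octonion) : x = ∑ i, x i • e i := by
  apply ext8 <;> simp [Fin.sum_univ_eight, e]

theorem eq_smul_one_add_associators (q : Octonion) :
    q = q 0 • (1 : Octonion) + (q 1 / 2) • associator (e 2) (e 5) (e 6)
      + (q 2 / 2) • associator (e 1) (e 4) (e 7) + (q 3 / 2) • associator (e 1) (e 6) (e 4)
      + (q 4 / 2) • associator (e 1) (e 3) (e 6) + (q 5 / 2) • associator (e 1) (e 2) (e 6)
      + (q 6 / 2) • associator (e 1) (e 4) (e 3) + (q 7 / 2) • associator (e 1) (e 2) (e 4) := by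
  apply ext8 <;>
    simp [associator_apply, e, one_apply, mul_apply0, mul_apply1, mul_apply2, mul_apply3,
      mul_apply4, mul_apply5, mul_apply6, mul_apply7] <;> ring

theorem linearMap_ext {N : Type*} [AddCommGroup N] [Module ℝ N] {f g : Octonion →ₗ[ℝ] N}
    (h_one : f 1 = g 1) (h_associator : ∀ x y z, f (associator x y z) = g (associator x y z)) :
    f = g :=
  LinearMap.ext fun q => by
    rw [eq_smul_one_add_associators q]
    simp only [map_add, map_smul, h_one, h_associator]

theorem conj_eq (x : Octonion) : conj x = (2 * x 0) • (1 : Octonion) - x := by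
  ext i
  by_cases hi : i = 0
  · subst hi
    simp only [conj, if_true, sub_apply, smul_apply, one_apply_zero]
    ring
  · simp [conj, one_apply, hi]

theorem conj_apply_zero (x : Octonion) : conj x 0 = x 0 := rfl

theorem conj_one : conj 1 = 1 := by
  rw [conj_eq, one_apply_zero]
  module

theorem conj_conj (x : Octonion) : conj (conj x) = x := by
  apply ext8 <;> simp [conj]

theorem conj_mul (x y : Octonion) : conj (x * y) = conj y * conj x := by
  apply ext8 <;> simp [conj, mul_apply0, mul_apply1, mul_apply2, mul_apply3, mul_apply4,
    mul_apply5, mul_apply6, mul_apply7] <;> ring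

theorem conj_mul_apply_zero (x y : Octonion) : (conj x * y) 0 = (x * conj y) 0 := by
  simp [mul_apply0, conj]

theorem associator_conj_self (x y : Octonion) : associator (conj x) x y = 0 := by
  rw [conj_eq, ← neg_eq_zero, ← associator_self_left x y]
  simp only [associator_apply, sub_mul, smul_mul_assoc, one_mul]
  abel

theorem associator_mid_conj (x y : Octonion) : associator x y (conj y) = 0 := by
  rw [associator_cycl, associator_swap, associator_conj_self, neg_zero]

theorem conj_mem_span_one (x : Octonion) : conj x ∈ Submodule.span ℝ {1, x} := by
  rw [conj_eq]
  exact sub_mem (Submodule.smul_mem _ _ (Submodule.subset_span (Set.mem_insert _ _)))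
    (Submodule.subset_span (Set.mem_insert_of_mem _ rfl))

theorem mul_conj_apply_zero (x y : Octonion) : (x * conj y) 0 = ∑ i, x i * y i := by
  simp [mul_apply0, conj, Fin.sum_univ_eight]

theorem mul_conj_e_apply_zero (x : Octonion) (i : Fin 8) : (x * conj (e i)) 0 = x i := by
  fin_cases i <;> simp [mul_apply0, e, conj]

theorem eq_zero_of_mul_conj_self_apply_zero {x : Octonion} (hx : (x * conj x) 0 = 0) : x = 0 := by
  rw [mul_conj_apply_zero, Finset.sum_eq_zero_iff_of_nonneg fun i _ => mul_self_nonneg (x i)] at hx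
  ext i
  exact mul_self_eq_zero.1 (hx i (Finset.mem_univ i))

theorem eq_of_forall_mul_apply_zero {x y : Octonion} (h : ∀ p, (x * p) 0 = (y * p) 0) : x = y := by
  ext i
  rw [← mul_conj_e_apply_zero x, h, mul_conj_e_apply_zero]

theorem e_succ_mul_self (i : Fin 7) : e i.succ * e i.succ = -1 := by
  apply ext8 <;> fin_cases i <;> simp [mul_apply0, mul_apply1, mul_apply2, mul_apply3,
    mul_apply4, mul_apply5, mul_apply6, mul_apply7, e, one_apply]

theorem rePart_eq (x : Octonion) : rePart x = x 0 • (1 : Octonion) := by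
  simp only [rePart, lmul_eq_mul, rmul_eq_mul, Fin.sum_univ_seven]
  apply ext8 <;>
  simp [e, one_apply, mul_apply0, mul_apply1, mul_apply2, mul_apply3, mul_apply4,
    mul_apply5, mul_apply6, mul_apply7] <;> ring

namespace IsImagUnit

variable {J : Octonion}

theorem conj_eq (hJ : J.IsImagUnit) : conj J = -J := by
  rw [Octonion.conj_eq, hJ.1, mul_zero, zero_smul, zero_sub]

theorem conj (hJ : J.IsImagUnit) : (conj J).IsImagUnit :=
  ⟨hJ.1, by rw [conj_conj, hJ.conj_eq, neg_mul, ← mul_neg, ← hJ.conj_eq, hJ.2]⟩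

theorem mul_self (hJ : J.IsImagUnit) : J * J = -1 := by
  rw [← hJ.2, hJ.conj_eq, mul_neg, neg_neg]

theorem mul_mul (hJ : J.IsImagUnit) (p : Octonion) : J * (J * p) = -p := by
  rw [← sub_eq_zero.1 (associator_self_left J p), hJ.mul_self, neg_mul, one_mul]

/-- Applying `[J, ·, p]` to the relation `h` and to `J` times it gives two linear equations for
`[J, K, p]` and `[J, J K, p]`, with determinant `-(s² + t²)`. -/
theorem smul_associator_eq_zero (hJ : J.IsImagUnit) {K : Octonion} {x y s t : ℝ}
    (h : x • (1 : Octonion) + y • J + s • K + t • (J * K) = 0) (p : Octonion) :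
    t • associator J K p = 0 := by
  have h' : x • J - y • (1 : Octonion) + s • (J * K) - t • K = 0 := by
    have := congrArg (J * ·) h
    simp only [mul_add, mul_smul_comm, mul_one, hJ.mul_self, hJ.mul_mul, mul_zero] at this
    rw [← this]
    module
  have eq₁ : s • associator J K p + t • associator J (J * K) p = 0 := by
    have := congrArg (associator J · p) h
    simpa only [associator_add_mid, associator_smul_mid, associator_one_mid, associator_self_left,
      smul_zero, zero_add, associator_apply J 0, mul_zero, zero_mul, sub_zero] using this
  have eq₂ : s • associator J (J * K) p - t • associator J K p = 0 := by
    have := congrArg (associator J · p) h'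
    simpa only [sub_eq_add_neg, ← neg_smul, associator_add_mid, associator_smul_mid,
      associator_one_mid, associator_self_left, smul_zero, zero_add, associator_apply J 0, mul_zero,
      zero_mul, neg_zero, add_zero] using this
  have h_det : (s ^ 2 + t ^ 2) • associator J K p = 0 := by
    linear_combination (norm := module) s • eq₁ - t • eq₂
  rcases eq_or_ne t 0 with rfl | ht
  · rw [zero_smul]
  · rw [(smul_eq_zero.1 h_det).resolve_left (by positivity), smul_zero]

end IsImagUnit

end Octonion

section Bimodule

open Octonion

variable {M N : Type*} [AddCommGroup M] [Module ℝ M] [OctonionBimodule M]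
  [AddCommGroup N] [Module ℝ N]

/-- The associator `[p, q, x]` of a bimodule as a linear map in `x`. By the bimodule identities it
can be written with `x` in any of the three positions; the last one, `[x, p, q] = (xp)q - x(pq)`, is
chosen because `𝕆`-linear combinations are formed with scalars on the right. -/
noncomputable def bimoduleAssoc (p q : Octonion) : M →ₗ[ℝ] M :=
  rmul.flip q ∘ₗ rmul.flip p - rmul.flip (p * q)

theorem bimoduleAssoc_eq_right (p q : Octonion) (x : M) :
    bimoduleAssoc p q x = rmul (rmul x p) q - rmul x (p * q) := rfl

theorem bimoduleAssoc_eq_left (p q : Octonion) (x : M) :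
    bimoduleAssoc p q x = lmul (p * q) x - lmul p (lmul q x) :=
  ((assoc_left_mid p q x).trans (assoc_mid_right p q x)).symm

theorem bimoduleAssoc_eq_mid (p q : Octonion) (x : M) :
    bimoduleAssoc p q x = rmul (lmul q x) p - lmul q (rmul x p) :=
  (assoc_mid_right p q x).symm

theorem bimoduleAssoc_swap (p q : Octonion) (x : M) :
    bimoduleAssoc p q x = -bimoduleAssoc q p x := by
  rw [bimoduleAssoc_eq_left q p]
  exact assoc_right_left p q x

theorem bimoduleAssoc_conj_conj (p q : Octonion) (x : M) :
    bimoduleAssoc (conj q) (conj p) x = -bimoduleAssoc p q x := by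
  rw [bimoduleAssoc_swap p q, neg_neg, conj_eq, conj_eq]
  simp only [bimoduleAssoc_eq_right, sub_mul, mul_sub, smul_mul_assoc, mul_smul_comm, one_mul,
    mul_one, map_sub, map_smul, LinearMap.sub_apply, LinearMap.smul_apply, rmul_one]
  module

namespace IsRealVec

variable {n : M}

theorem bimoduleAssoc_eq_zero (hn : IsRealVec n) (p q : Octonion) : bimoduleAssoc p q n = 0 := by
  rw [bimoduleAssoc_eq_left, hn p q]

theorem rmul_rmul (hn : IsRealVec n) (p q : Octonion) : rmul (rmul n p) q = rmul n (p * q) :=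
  sub_eq_zero.1 (hn.bimoduleAssoc_eq_zero p q)

theorem lmul_lmul (hn : IsRealVec n) (p q : Octonion) : lmul p (lmul q n) = lmul (p * q) n :=
  (sub_eq_zero.1 (hn p q)).symm

theorem rmul_lmul (hn : IsRealVec n) (p q : Octonion) :
    rmul (lmul q n) p = lmul q (rmul n p) :=
  sub_eq_zero.1 ((bimoduleAssoc_eq_mid p q n).symm.trans (hn.bimoduleAssoc_eq_zero p q))

theorem bimoduleAssoc_rmul (hn : IsRealVec n) (p q r : Octonion) :
    bimoduleAssoc p q (rmul n r) = rmul n (associator r p q) := by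
  simp only [bimoduleAssoc_eq_right, hn.rmul_rmul, associator_apply, map_sub]

theorem lmul_eq_rmul (hn : IsRealVec n) (p : Octonion) : lmul p n = rmul n p := by
  refine LinearMap.congr_fun (linearMap_ext (f := lmul.flip n) ?_ fun x y z => ?_) p
  · rw [LinearMap.flip_apply, one_lmul, rmul_one]
  calc lmul (associator x y z) n
    _ = bimoduleAssoc x y (lmul z n) := by
      simp only [bimoduleAssoc_eq_left, hn.lmul_lmul, associator_apply, map_sub,
        LinearMap.sub_apply]
    _ = bimoduleAssoc y z (rmul n x) := by
      rw [bimoduleAssoc_eq_right, bimoduleAssoc_eq_mid, hn.rmul_lmul, hn.rmul_lmul, hn.rmul_rmul]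
    _ = rmul n (associator x y z) := hn.bimoduleAssoc_rmul y z x

theorem rePart_rmul (hn : IsRealVec n) (p : Octonion) : rePart (rmul n p) = p 0 • n := by
  have h : rePart (rmul n p) = rmul n (rePart p) := by
    simp only [rePart, map_sub, map_smul, map_sum, ← hn.rmul_lmul, hn.lmul_eq_rmul, hn.rmul_rmul,
      lmul_eq_mul, rmul_eq_mul]
  rw [h, rePart_eq, map_smul, rmul_one]

end IsRealVec

theorem rePart_add (x y : M) : rePart (x + y) = rePart x + rePart y := by
  simp only [rePart, map_add, LinearMap.add_apply, Finset.sum_add_distrib]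
  module

/-- The linear maps that vanish on all associators of a bimodule. On a Hilbert bimodule the
functionals `⟪a, ·⟫` with `a` real are of this kind, and they detect the real part. -/
def VanishesOnAssociators (φ : M →ₗ[ℝ] N) : Prop := ∀ p q x, φ (bimoduleAssoc p q x) = 0

namespace VanishesOnAssociators

variable {φ : M →ₗ[ℝ] N}

theorem map_rmul_rmul (hφ : VanishesOnAssociators φ) (p q : Octonion) (x : M) :
    φ (rmul (rmul x p) q) = φ (rmul x (p * q)) := by
  have h := hφ p q x
  rwa [bimoduleAssoc_eq_right, map_sub, sub_eq_zero] at h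

theorem map_lmul_lmul (hφ : VanishesOnAssociators φ) (p q : Octonion) (x : M) :
    φ (lmul p (lmul q x)) = φ (lmul (p * q) x) := by
  have h := hφ p q x
  rwa [bimoduleAssoc_eq_left, map_sub, sub_eq_zero, eq_comm] at h

theorem map_rmul_lmul (hφ : VanishesOnAssociators φ) (p q : Octonion) (x : M) :
    φ (rmul (lmul q x) p) = φ (lmul q (rmul x p)) := by
  have h := hφ p q x
  rwa [bimoduleAssoc_eq_mid, map_sub, sub_eq_zero] at h

theorem map_rmul_associator (hφ : VanishesOnAssociators φ) (p q r : Octonion) (x : M) :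
    φ (rmul x (associator p q r)) = φ (rmul (bimoduleAssoc q p x) r) := by
  rw [bimoduleAssoc_swap, bimoduleAssoc_eq_right, neg_sub, associator_apply, map_sub,
    LinearMap.map_sub₂, map_sub, map_sub, ← hφ.map_rmul_rmul (p * q), ← hφ.map_rmul_rmul p,
    ← hφ.map_rmul_rmul q]

theorem map_lmul_associator (hφ : VanishesOnAssociators φ) (p q r : Octonion) (x : M) :
    φ (lmul (associator p q r) x) = φ (rmul (bimoduleAssoc q p x) r) := by
  calc φ (lmul (associator p q r) x)
    _ = -φ (lmul p (bimoduleAssoc q r x)) := by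
      rw [bimoduleAssoc_eq_left, associator_apply, LinearMap.map_sub₂, map_sub, map_sub, map_sub,
        hφ.map_lmul_lmul, hφ.map_lmul_lmul, hφ.map_lmul_lmul, neg_sub]
    _ = φ (rmul (lmul p x) (q * r)) - φ (rmul (lmul p (rmul x q)) r) := by
      rw [bimoduleAssoc_eq_right, map_sub, map_sub, hφ.map_rmul_lmul, hφ.map_rmul_lmul, neg_sub]
    _ = φ (rmul (bimoduleAssoc q p x) r) := by
      rw [bimoduleAssoc_eq_mid, LinearMap.map_sub₂, map_sub, hφ.map_rmul_rmul]

theorem map_lmul (hφ : VanishesOnAssociators φ) (p : Octonion) (x : M) :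
    φ (lmul p x) = φ (rmul x p) := by
  refine LinearMap.congr_fun (linearMap_ext (f := φ ∘ₗ lmul.flip x) (g := φ ∘ₗ rmul x) ?_ ?_) p
  · simp only [LinearMap.comp_apply, LinearMap.flip_apply, one_lmul, rmul_one]
  · exact fun p q r => (hφ.map_lmul_associator p q r x).trans (hφ.map_rmul_associator p q r x).symm

theorem map_rePart (hφ : VanishesOnAssociators φ) (x : M) : φ (rePart x) = φ x := by
  have h (i : Fin 7) : φ (rmul (lmul (e i.succ) x) (e i.succ)) = -φ x := by
    rw [← hφ.map_lmul, hφ.map_lmul_lmul, e_succ_mul_self, LinearMap.map_neg₂, one_lmul, map_neg]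
  simp only [rePart, map_sub, map_smul, map_sum, h, Finset.sum_const, Finset.card_univ,
    Fintype.card_fin]
  module

end VanishesOnAssociators

theorem exists_of_mem_sliceCone {z : M} (hz : z ∈ sliceCone M) :
    ∃ (J : Octonion) (a b : M), J.IsImagUnit ∧ IsRealVec a ∧ IsRealVec b ∧ z = a + rmul b J := by
  obtain ⟨J, hJ, a, b, ha, hb, rfl⟩ := hz
  exact ⟨J, a, b, hJ, ha, hb, by rw [hb.lmul_eq_rmul]⟩

theorem IsRealVec.rmul_add_rmul {a b : M} (hb : IsRealVec b) (J p : Octonion) :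
    rmul (a + rmul b J) p = rmul a p + rmul b (J * p) := by
  rw [map_add, LinearMap.add_apply, hb.rmul_rmul]

theorem rmul_smul_one (x : M) (r : ℝ) : rmul x (r • (1 : Octonion)) = r • x := by
  rw [map_smul, rmul_one]

end Bimodule

section CompactSymmetric

variable {𝕜 E F : Type*} [RCLike 𝕜] [NormedAddCommGroup E] [InnerProductSpace 𝕜 E]
  [NormedAddCommGroup F] [InnerProductSpace 𝕜 F]

theorem tendsto_inner_orthonormal_cofinite {ι : Type*} {v : ι → E} (hv : Orthonormal 𝕜 v) (x : E) :
    Tendsto (fun i => inner 𝕜 x (v i)) cofinite (𝓝 0) := by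
  have h := hv.inner_products_summable (x := x) |>.tendsto_cofinite_zero
  rw [tendsto_zero_iff_norm_tendsto_zero]
  simpa only [norm_inner_symm x, Real.sqrt_sq (norm_nonneg _), Real.sqrt_zero] using h.sqrt

variable [CompleteSpace E]

theorem tendsto_map_orthonormal_cofinite {T : E →L[𝕜] F} (hT : IsCompactOperator T) {ι : Type*}
    {v : ι → E} (hv : Orthonormal 𝕜 v) : Tendsto (fun i => T (v i)) cofinite (𝓝 0) := by
  obtain ⟨K, hK, hTK⟩ := hT.image_closedBall_subset_compact (f := (T : E →ₗ[𝕜] F)) 1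
  have hmem (i : ι) : T (v i) ∈ K := hTK ⟨v i, by simp [hv.1 i], rfl⟩
  refine hK.tendsto_nhds_of_unique_mapClusterPt (.of_forall hmem) fun y _ hy => ?_
  have h_weak : Tendsto (fun i => inner 𝕜 y (T (v i))) cofinite (𝓝 0) := by
    simpa only [InnerProductSpace.toDual_symm_apply, ContinuousLinearMap.comp_apply,
      innerSL_apply_apply] using
      tendsto_inner_orthonormal_cofinite hv ((InnerProductSpace.toDual 𝕜 E).symm (innerSL 𝕜 y ∘L T))
  have h_cluster : MapClusterPt (inner 𝕜 y y) cofinite fun i => inner 𝕜 y (T (v i)) :=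
    hy.continuousAt_comp (continuous_const.inner continuous_id).continuousAt
  exact inner_self_eq_zero.1 (eq_of_nhds_neBot (ClusterPt.mono h_cluster h_weak))

theorem tendsto_eigenvalues_cofinite {T : E →L[𝕜] E} (hT : IsCompactOperator T) {ι : Type*}
    {v : ι → E} (hv : Orthonormal 𝕜 v) {lam : ι → 𝕜} (hlam : ∀ i, T (v i) = lam i • v i) :
    Tendsto lam cofinite (𝓝 0) := by
  have h := tendsto_zero_iff_norm_tendsto_zero.1 (tendsto_map_orthonormal_cofinite hT hv)
  simpa only [hlam, norm_smul, hv.1, mul_one, ← tendsto_zero_iff_norm_tendsto_zero] using h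

theorem eq_zero_of_forall_inner_eigenvector_eq_zero {T : E →L[𝕜] E} (hT : IsCompactOperator T)
    (hsymm : (T : E →ₗ[𝕜] E).IsSymmetric) {x : E}
    (hx : ∀ (r : 𝕜) (y : E), T y = r • y → inner 𝕜 y x = 0) : x = 0 := by
  rw [← Submodule.mem_bot (R := 𝕜),
    ← ContinuousLinearMap.orthogonalComplement_iSup_eigenspaces_eq_bot hT hsymm,
    ← Submodule.iInf_orthogonal, Submodule.mem_iInf]
  exact fun r y hy => hx r y (Module.End.mem_eigenspace_iff.1 hy)

theorem map_eq_smul_of_forall_inner_eigenvector_eq_zero {T : E →L[𝕜] E} (hT : IsCompactOperator T)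
    (hsymm : (T : E →ₗ[𝕜] E).IsSymmetric) {r : 𝕜} {x : E}
    (hx : ∀ t ≠ r, ∀ y, T y = t • y → inner 𝕜 y x = 0) : T x = r • x := by
  refine sub_eq_zero.1 (eq_zero_of_forall_inner_eigenvector_eq_zero hT hsymm fun t y hy => ?_)
  have h_inner : inner 𝕜 y (T x - r • x) = (starRingEnd 𝕜 t - r) * inner 𝕜 y x := by
    rw [inner_sub_right, ← T.coe_coe, ← hsymm, T.coe_coe, hy, inner_smul_left, inner_smul_right,
      sub_mul]
  rw [h_inner]
  rcases eq_or_ne t r with rfl | ht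
  · rcases eq_or_ne y 0 with rfl | hy_ne
    · rw [inner_zero_left, mul_zero]
    · have h_eig : Module.End.HasEigenvalue (T : E →ₗ[𝕜] E) t :=
        Module.End.hasEigenvalue_of_hasEigenvector ⟨Module.End.mem_eigenspace_iff.2 hy, hy_ne⟩
      rw [hsymm.conj_eigenvalue_eq_self h_eig, sub_self, zero_mul]
  · rw [hx t ht y hy, mul_zero]

end CompactSymmetric

section Hilbert

open Octonion
open scoped RealInnerProductSpace

variable {H : Type u} [NormedAddCommGroup H] [InnerProductSpace ℝ H] [CompleteSpace H]
  [HilbertOctonionBimodule H]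

theorem oinner_apply_zero (u v : H) : oinner u v 0 = ⟪u, v⟫ := by
  have h_symm : oinner v u 0 = oinner u v 0 := by rw [oinner_conj u v, conj_apply_zero]
  have h_self (x : H) : oinner x x 0 = ‖x‖ ^ 2 := by
    rw [oinner_self, smul_apply, one_apply_zero, mul_one]
  have h_add := h_self (u + v)
  simp only [map_add, LinearMap.add_apply, Octonion.add_apply, h_self, h_symm] at h_add
  linarith [norm_add_sq_real u v]

theorem inner_rmul_right (u v : H) (p : Octonion) : ⟪u, rmul v p⟫ = (oinner u v * p) 0 := by
  have h := congrFun (oinner_paraLinear u p v) 0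
  rw [rePart_eq, smul_apply, one_apply_zero, mul_one, secondAssoc, Octonion.sub_apply,
    oinner_apply_zero, rmul_eq_mul, zero_apply, sub_eq_zero] at h
  exact h.symm

theorem inner_rmul_left (u v : H) (p : Octonion) : ⟪rmul u p, v⟫ = ⟪u, rmul v (conj p)⟫ := by
  rw [real_inner_comm, inner_rmul_right, inner_rmul_right, oinner_conj v u, conj_mul_apply_zero]

theorem oinner_apply (u v : H) (i : Fin 8) : oinner u v i = ⟪rmul u (e i), v⟫ := by
  rw [inner_rmul_left, inner_rmul_right, mul_conj_e_apply_zero]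

theorem oinner_eq_zero_iff {u v : H} : oinner u v = 0 ↔ ∀ p, ⟪rmul u p, v⟫ = 0 := by
  refine ⟨fun h p => ?_, fun h => ?_⟩
  · rw [inner_rmul_left, inner_rmul_right, h, zero_mul, zero_apply]
  · ext i
    rw [oinner_apply, h, zero_apply]

theorem inner_bimoduleAssoc_left (p q : Octonion) (u v : H) :
    ⟪bimoduleAssoc p q u, v⟫ = -⟪u, bimoduleAssoc p q v⟫ := by
  rw [← inner_neg_right, ← bimoduleAssoc_conj_conj]
  simp only [bimoduleAssoc_eq_right, inner_sub_left, inner_sub_right, inner_rmul_left, conj_mul]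

theorem secondAssoc_oinner_mul_apply_zero (p q : Octonion) (u x : H) :
    (secondAssoc p (oinner u) x * q) 0 = ⟪bimoduleAssoc p q u, x⟫ := by
  rw [inner_bimoduleAssoc_left, bimoduleAssoc_eq_right, inner_sub_right, inner_rmul_right,
    inner_rmul_right, secondAssoc, rmul_eq_mul, sub_mul, Octonion.sub_apply, mul_mul_apply_zero,
    neg_sub]

namespace IsRealVec

variable {a b c d : H}

theorem vanishesOnAssociators_inner (ha : IsRealVec a) : VanishesOnAssociators (innerₗ H a) :=
  fun p q x => by
    rw [innerₗ_apply_apply, ← neg_eq_zero, ← inner_bimoduleAssoc_left, ha.bimoduleAssoc_eq_zero,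
      inner_zero_left]

theorem inner_rePart (ha : IsRealVec a) (x : H) : ⟪a, rePart x⟫ = ⟪a, x⟫ :=
  ha.vanishesOnAssociators_inner.map_rePart x

theorem inner_rmul (ha : IsRealVec a) (hb : IsRealVec b) (p : Octonion) :
    ⟪a, rmul b p⟫ = ⟪a, b⟫ * p 0 := by
  rw [← ha.inner_rePart, hb.rePart_rmul, real_inner_smul_right, mul_comm]

theorem oinner_rmul_rmul (ha : IsRealVec a) (hb : IsRealVec b) (p q : Octonion) :
    oinner (rmul a p) (rmul b q) = ⟪a, b⟫ • (conj p * q) :=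
  eq_of_forall_mul_apply_zero fun r => by
    rw [← inner_rmul_right, inner_rmul_left, hb.rmul_rmul, hb.rmul_rmul, ha.inner_rmul hb,
      mul_apply_zero_comm, ← mul_mul_apply_zero, smul_mul_assoc, smul_apply]

theorem oinner_rmul (ha : IsRealVec a) (hb : IsRealVec b) (p : Octonion) :
    oinner a (rmul b p) = ⟪a, b⟫ • p := by
  rw [← rmul_one a, ha.oinner_rmul_rmul hb, rmul_one, conj_one, one_mul]

theorem oinner_add_rmul_add_rmul (ha : IsRealVec a) (hb : IsRealVec b) (hc : IsRealVec c)
    (hd : IsRealVec d) (J K p : Octonion) :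
    oinner (a + rmul b J) (rmul (c + rmul d K) p) =
      ⟪a, c⟫ • p + ⟪b, c⟫ • (conj J * p) + ⟪a, d⟫ • (K * p) + ⟪b, d⟫ • (conj J * (K * p)) := by
  rw [hd.rmul_add_rmul]
  simp only [map_add, LinearMap.add_apply, ha.oinner_rmul hc, ha.oinner_rmul hd,
    hb.oinner_rmul_rmul hc, hb.oinner_rmul_rmul hd]
  abel

theorem secondAssoc_oinner_add_rmul (ha : IsRealVec a) (hb : IsRealVec b) (hc : IsRealVec c)
    (hd : IsRealVec d) (J K p : Octonion) :
    secondAssoc p (oinner (a + rmul b J)) (c + rmul d K) =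
      ⟪b, d⟫ • associator (conj J) K p := by
  rw [secondAssoc, ← rmul_one (c + rmul d K), ha.oinner_add_rmul_add_rmul hb hc hd, rmul_one,
    ha.oinner_add_rmul_add_rmul hb hc hd]
  simp only [rmul_eq_mul, mul_one, add_mul, smul_mul_assoc, one_mul, associator_apply]
  module

end IsRealVec

theorem secondAssoc_oinner_self {z : H} (hz : z ∈ sliceCone H) (p : Octonion) :
    secondAssoc p (oinner z) z = 0 := by
  obtain ⟨J, a, b, -, ha, hb, rfl⟩ := exists_of_mem_sliceCone hz
  rw [ha.secondAssoc_oinner_add_rmul hb ha hb, associator_conj_self, smul_zero]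

theorem secondAssoc_oinner_eq_zero {z w : H} (hz : z ∈ sliceCone H) (hw : w ∈ sliceCone H)
    (hzw : oinner z w = 0) (p : Octonion) : secondAssoc p (oinner z) w = 0 := by
  obtain ⟨J, a, b, hJ, ha, hb, rfl⟩ := exists_of_mem_sliceCone hz
  obtain ⟨K, c, d, -, hc, hd, rfl⟩ := exists_of_mem_sliceCone hw
  rw [← rmul_one (c + rmul d K), ha.oinner_add_rmul_add_rmul hb hc hd, mul_one, mul_one] at hzw
  rw [ha.secondAssoc_oinner_add_rmul hb hc hd]
  exact hJ.conj.smul_associator_eq_zero hzw p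

theorem inner_rmul_rmul_eq_zero {z w : H} (hz : z ∈ sliceCone H) (hw : w ∈ sliceCone H)
    (hzw : oinner z w = 0) (p q : Octonion) : ⟪rmul z p, rmul w q⟫ = 0 := by
  have h := secondAssoc_oinner_eq_zero hz hw hzw q
  rw [secondAssoc, hzw, map_zero, LinearMap.zero_apply, zero_sub, neg_eq_zero] at h
  exact oinner_eq_zero_iff.1 h p

/-- Both `o = ⟨z, w⟩` and its conjugate `⟨w, z⟩` are combinations of products of elements of
`span {1, J}` and `span {1, K}`, so the hypothesis gives `|o|² = Re (o * conj o) = 0`. -/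
theorem oinner_eq_zero_of_forall_mem_span_one {a b c d : H} (ha : IsRealVec a) (hb : IsRealVec b)
    (hc : IsRealVec c) (hd : IsRealVec d) {J K : Octonion}
    (h : ∀ p ∈ Submodule.span ℝ {1, J}, ∀ q ∈ Submodule.span ℝ {1, K},
      ⟪rmul (a + rmul b J) p, rmul (c + rmul d K) q⟫ = 0) :
    oinner (a + rmul b J) (c + rmul d K) = 0 := by
  set z := a + rmul b J
  set w := c + rmul d K
  set o := oinner z w with ho_def
  have one_mem (p : Octonion) : 1 ∈ Submodule.span ℝ {1, p} :=
    Submodule.subset_span (Set.mem_insert _ _)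
  have h_rmul : oinner z (rmul w (conj K)) = o * conj K := by
    rw [eq_comm, ← sub_eq_zero, ← rmul_eq_mul, ho_def]
    exact (ha.secondAssoc_oinner_add_rmul hb hc hd J K (conj K)).trans
      (by rw [associator_mid_conj, smul_zero])
  have h_one : o 0 = 0 := by
    rw [ho_def, oinner_apply_zero, ← rmul_one z, ← rmul_one w]
    exact h 1 (one_mem J) 1 (one_mem K)
  have h_J : (o * J) 0 = 0 := by
    rw [ho_def, ← inner_rmul_right, ← conj_conj J, ← inner_rmul_left, ← rmul_one w]
    exact h (conj J) (conj_mem_span_one J) 1 (one_mem K)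
  have h_K : (o * conj K) 0 = 0 := by
    rw [ho_def, ← inner_rmul_right, ← rmul_one z]
    exact h 1 (one_mem J) (conj K) (conj_mem_span_one K)
  have h_KJ : (o * (conj K * J)) 0 = 0 := by
    rw [← mul_mul_apply_zero, ← h_rmul, ← inner_rmul_right, ← conj_conj J, ← inner_rmul_left]
    exact h (conj J) (conj_mem_span_one J) (conj K) (conj_mem_span_one K)
  have h_conj : conj o = ⟪c, a⟫ • (1 : Octonion) + ⟪d, a⟫ • conj K + ⟪c, b⟫ • J +
      ⟪d, b⟫ • (conj K * J) := by
    rw [ho_def, ← oinner_conj, ← rmul_one z, hc.oinner_add_rmul_add_rmul hd ha hb, mul_one, mul_one]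
  refine eq_zero_of_mul_conj_self_apply_zero ?_
  simp only [h_conj, mul_add, mul_smul_comm, mul_one, Octonion.add_apply, smul_apply, h_one, h_J,
    h_K, h_KJ, mul_zero, add_zero]

theorem isParaLinear_sliceProj {z : H} (hz : z ∈ sliceCone H) : IsParaLinear (sliceProj z) := by
  intro p x
  obtain ⟨J, a, b, -, ha, hb, rfl⟩ := exists_of_mem_sliceCone hz
  set z := a + rmul b J with hz_def
  set d := secondAssoc p (oinner z) x with hd_def
  have hd : d 0 = 0 := by
    rw [← mul_one d, hd_def, secondAssoc_oinner_mul_apply_zero, bimoduleAssoc_eq_right, rmul_one,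
      mul_one, sub_self, inner_zero_left]
  have hJd : (J * d) 0 = 0 := by
    rw [mul_apply_zero_comm, hd_def, secondAssoc_oinner_mul_apply_zero, hz_def, map_add,
      ha.bimoduleAssoc_eq_zero, hb.bimoduleAssoc_rmul, associator_self_outer, map_zero, add_zero,
      inner_zero_left]
  have h_rmul (q : Octonion) : rmul z q = rmul a q + rmul b (J * q) := hb.rmul_add_rmul J q
  have h_eq : secondAssoc p (sliceProj z) x =
      rmul a d + rmul b (associator J (oinner z x) p + J * d) := by
    simp only [secondAssoc, sliceProj, LinearMap.comp_apply, hd_def, rmul_eq_mul, associator_apply,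
      mul_sub, map_add, map_sub, h_rmul, LinearMap.add_apply, ha.rmul_rmul, hb.rmul_rmul]
    abel
  rw [h_eq, rePart_add, ha.rePart_rmul, hb.rePart_rmul, hd, Octonion.add_apply, hJd,
    associator_apply_zero, add_zero, zero_smul, zero_smul, add_zero]

theorem sliceProj_eq_sum (z x : H) : sliceProj z x = ∑ i, ⟪rmul z (e i), x⟫ • rmul z (e i) := by
  conv_lhs => rw [sliceProj, LinearMap.comp_apply, eq_sum_smul_e (oinner z x)]
  simp only [map_sum, map_smul, oinner_apply]

theorem IsOctonionSelfAdjoint.isSymmetric {T : H →L[ℝ] H} (hT : IsOctonionSelfAdjoint T) :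
    (T : H →ₗ[ℝ] H).IsSymmetric := by
  intro x y
  have h := congrFun ((hT x).2 y) 0
  rwa [rePart_eq, rePart_eq, smul_apply, smul_apply, one_apply_zero, mul_one, mul_one,
    oinner_apply_zero, oinner_apply_zero] at h

section Operator

variable {T : H →ₗ[ℝ] H}

theorem IsParaLinear.inner_map_rmul {M : Type*} [AddCommGroup M] [Module ℝ M] [OctonionBimodule M]
    {f : M →ₗ[ℝ] H} (hf : IsParaLinear f) {a : H} (ha : IsRealVec a) (x : M) (p : Octonion) :
    ⟪a, f (rmul x p)⟫ = ⟪a, rmul (f x) p⟫ := by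
  have h : ⟪a, secondAssoc p f x⟫ = 0 := by rw [← ha.inner_rePart, hf p x, inner_zero_right]
  rw [secondAssoc, inner_sub_right, sub_eq_zero] at h
  exact h.symm

theorem IsParaLinear.map_rmul_of_isRealVec (hT : IsParaLinear T) (hsymm : T.IsSymmetric) {a : H}
    (ha : IsRealVec a) (p : Octonion) : T (rmul a p) = rmul (T a) p := by
  refine ext_inner_right ℝ fun x => ?_
  calc ⟪T (rmul a p), x⟫
    _ = ⟪a, rmul (T x) (conj p)⟫ := by rw [hsymm, inner_rmul_left]
    _ = ⟪a, T (rmul x (conj p))⟫ := (hT.inner_map_rmul ha x _).symm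
    _ = ⟪rmul (T a) p, x⟫ := by rw [← hsymm, inner_rmul_left]

theorem IsParaLinear.map_rmul_of_mem_span_one (hT : IsParaLinear T) (hsymm : T.IsSymmetric)
    {a b : H} (ha : IsRealVec a) (hb : IsRealVec b) {J p : Octonion}
    (hp : p ∈ Submodule.span ℝ {1, J}) :
    T (rmul (a + rmul b J) p) = rmul (T (a + rmul b J)) p := by
  have h_assoc : bimoduleAssoc J p (T b) = 0 := by
    obtain ⟨x, y, rfl⟩ := Submodule.mem_span_pair.1 hp
    have h_self : bimoduleAssoc J J (T b) = 0 := by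
      linear_combination (norm := module) (1 / 2 : ℝ) • bimoduleAssoc_swap J J (T b)
    rw [bimoduleAssoc_eq_right, sub_eq_zero] at h_self
    simp only [bimoduleAssoc_eq_right, mul_add, mul_smul_comm, mul_one, map_add, map_smul, rmul_one,
      h_self, sub_self]
  rw [bimoduleAssoc_eq_right, sub_eq_zero] at h_assoc
  rw [hb.rmul_add_rmul, map_add, map_add, LinearMap.map_add₂, hT.map_rmul_of_isRealVec hsymm ha,
    hT.map_rmul_of_isRealVec hsymm hb, hT.map_rmul_of_isRealVec hsymm hb, h_assoc]

theorem IsParaLinear.oinner_eq_zero_of_map_eq_smul (hT : IsParaLinear T) (hsymm : T.IsSymmetric)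
    {z w : H} (hz : z ∈ sliceCone H) (hw : w ∈ sliceCone H) {r t : ℝ} (hrt : r ≠ t)
    (hTz : T z = r • z) (hTw : T w = t • w) : oinner z w = 0 := by
  obtain ⟨J, a, b, -, ha, hb, rfl⟩ := exists_of_mem_sliceCone hz
  obtain ⟨K, c, d, -, hc, hd, rfl⟩ := exists_of_mem_sliceCone hw
  refine oinner_eq_zero_of_forall_mem_span_one ha hb hc hd fun p hp q hq => ?_
  have h_left : T (rmul (a + rmul b J) p) = r • rmul (a + rmul b J) p := by
    rw [hT.map_rmul_of_mem_span_one hsymm ha hb hp, hTz, LinearMap.map_smul₂]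
  have h_right : T (rmul (c + rmul d K) q) = t • rmul (c + rmul d K) q := by
    rw [hT.map_rmul_of_mem_span_one hsymm hc hd hq, hTw, LinearMap.map_smul₂]
  exact hsymm.orthogonalFamily_eigenspaces hrt ⟨_, Module.End.mem_eigenspace_iff.2 h_left⟩
    ⟨_, Module.End.mem_eigenspace_iff.2 h_right⟩

end Operator

theorem inner_eq_zero_of_mem_closure_octonionSpan {s : Set H} {x y : H}
    (hs : ∀ z ∈ s, ∀ p, ⟪rmul z p, x⟫ = 0) (hy : y ∈ closure (octonionSpan s)) :
    ⟪y, x⟫ = 0 := by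
  have h_closed : IsClosed {y : H | ⟪y, x⟫ = 0} :=
    isClosed_eq (continuous_id.inner continuous_const) continuous_const
  refine closure_minimal ?_ h_closed hy
  rintro _ ⟨N, z, p, hz, rfl⟩
  rw [Set.mem_ofPred_eq, sum_inner]
  exact Finset.sum_eq_zero fun k _ => hs _ (hz k) _

section Families

variable {ι κ : Type*} {v : ι → H}

theorem IsOctonionOrthonormal.orthonormal (hv : IsOctonionOrthonormal v) : Orthonormal ℝ v := by
  refine ⟨fun i => ?_, fun i j hij => ?_⟩
  · rw [norm_eq_sqrt_real_inner, ← oinner_apply_zero, hv.1, one_apply_zero, Real.sqrt_one]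
  · exact (oinner_apply_zero _ _).symm.trans (congrFun (hv.2 i j hij) 0)

theorem IsOctonionOrthonormal.isWeakAssocOrthonormal (hv : IsOctonionOrthonormal v)
    (hcone : ∀ i, v i ∈ sliceCone H) : IsWeakAssocOrthonormal v := by
  refine ⟨hv, fun p i j => ?_⟩
  rcases eq_or_ne i j with rfl | hij
  · exact secondAssoc_oinner_self (hcone i) p
  · exact secondAssoc_oinner_eq_zero (hcone i) (hcone j) (hv.2 i j hij) p

namespace IsWeakAssocOrthonormal

theorem oinner_rmul (hv : IsWeakAssocOrthonormal v) (i j : ι) (p : Octonion) :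
    oinner (v i) (rmul (v j) p) = oinner (v i) (v j) * p :=
  (sub_eq_zero.1 (hv.2 p i j)).symm

theorem sliceProj_sliceProj (hv : IsWeakAssocOrthonormal v) (i : ι) (x : H) :
    sliceProj (v i) (sliceProj (v i) x) = sliceProj (v i) x := by
  simp only [sliceProj, LinearMap.comp_apply, hv.oinner_rmul, hv.1.1, one_mul]

theorem orthonormal_rmul (hv : IsWeakAssocOrthonormal v) :
    Orthonormal ℝ fun k : ι × Fin 8 => rmul (v k.1) (e k.2) := by
  classical
  rw [orthonormal_iff_ite]
  rintro ⟨i, k⟩ ⟨j, l⟩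
  rw [← oinner_apply, hv.oinner_rmul]
  rcases eq_or_ne i j with rfl | hij
  · simp [hv.1.1, e]
  · simp [hv.1.2 i j hij, hij]

theorem hasSum_sliceProj (hv : IsWeakAssocOrthonormal v)
    (htotal : ∀ x, (∀ i, oinner (v i) x = 0) → x = 0) (x : H) :
    HasSum (fun i => sliceProj (v i) x) x := by
  have h_bot :
      (Submodule.span ℝ (Set.range fun k : ι × Fin 8 => rmul (v k.1) (e k.2)))ᗮ = ⊥ := by
    refine (Submodule.eq_bot_iff _).2 fun y hy => htotal y fun i => ?_
    ext k
    rw [oinner_apply]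
    exact hy _ (Submodule.subset_span ⟨(i, k), rfl⟩)
  refine ((HilbertBasis.mkOfOrthogonalEqBot hv.orthonormal_rmul h_bot).hasSum_repr
    x).prod_fiberwise fun i => ?_
  simp only [HilbertBasis.repr_apply_apply, HilbertBasis.coe_mkOfOrthogonalEqBot, sliceProj_eq_sum]
  exact hasSum_fintype _

theorem isWeakAssocOrthonormalBasis (hv : IsWeakAssocOrthonormal v)
    (htotal : ∀ x, (∀ i, oinner (v i) x = 0) → x = 0) : IsWeakAssocOrthonormalBasis v := by
  refine ⟨hv, fun s hvs hs => Set.Subset.antisymm (fun y hy => ?_) hvs⟩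
  by_contra hy_range
  refine hs.1.orthonormal.ne_zero ⟨y, hy⟩ (htotal y fun i => ?_)
  exact hs.1.2 ⟨v i, hvs ⟨i, rfl⟩⟩ ⟨y, hy⟩ fun h => hy_range ⟨i, congrArg Subtype.val h⟩

end IsWeakAssocOrthonormal

theorem IsWeakAssocOrthonormalBasis.comp_equiv (hv : IsWeakAssocOrthonormalBasis v) (f : κ ≃ ι) :
    IsWeakAssocOrthonormalBasis (v ∘ f) := by
  refine ⟨⟨⟨fun i => hv.1.1.1 (f i), fun i j hij => hv.1.1.2 _ _ (f.injective.ne hij)⟩,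
    fun p i j => hv.1.2 p (f i) (f j)⟩, ?_⟩
  rw [f.surjective.range_comp]
  exact hv.2

end Families

/-- `v` is an orthonormal family of strong eigenvectors of `T` for the real eigenvalues `lam`, such
that each eigenspace of `T` lies in the closed `𝕆`-span of the eigenvectors for its eigenvalue. -/
structure IsStrongEigensystem {ι : Type*} (T : H →L[ℝ] H) (v : ι → H) (lam : ι → ℝ) : Prop where
  orthonormal : IsOctonionOrthonormal v
  mem_sliceCone : ∀ i, v i ∈ sliceCone H
  map_eq : ∀ i, T (v i) = lam i • v i
  mem_closure : ∀ r y, T y = r • y → y ∈ closure (octonionSpan (v '' (lam ⁻¹' {r})))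

namespace IsStrongEigensystem

variable {ι : Type*} {T : H →L[ℝ] H} {v : ι → H} {lam : ι → ℝ}

theorem isWeakAssocOrthonormal (hv : IsStrongEigensystem T v lam) : IsWeakAssocOrthonormal v :=
  hv.orthonormal.isWeakAssocOrthonormal hv.mem_sliceCone

theorem isStrongEigenvector (hv : IsStrongEigensystem T v lam) (i : ι) :
    IsStrongEigenvector T (lam i • (1 : Octonion)) (v i) :=
  ⟨hv.mem_sliceCone i, hv.orthonormal.orthonormal.ne_zero i, by rw [rmul_smul_one, hv.map_eq]⟩

theorem tendsto_cofinite (hv : IsStrongEigensystem T v lam) (hT : IsCompactOperator T) :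
    Tendsto lam cofinite (𝓝 0) :=
  tendsto_eigenvalues_cofinite hT hv.orthonormal.orthonormal hv.map_eq

theorem eq_zero_of_forall_oinner_eq_zero (hv : IsStrongEigensystem T v lam)
    (hT : IsCompactOperator T) (hsymm : (T : H →ₗ[ℝ] H).IsSymmetric) (x : H)
    (hx : ∀ i, oinner (v i) x = 0) : x = 0 := by
  refine eq_zero_of_forall_inner_eigenvector_eq_zero hT hsymm fun r y hy =>
    inner_eq_zero_of_mem_closure_octonionSpan ?_ (hv.mem_closure r y hy)
  rintro _ ⟨i, -, rfl⟩
  exact oinner_eq_zero_iff.1 (hx i)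

/-- By orthonormality `v i 𝕆` is orthogonal to all eigenspaces of `T` but the one for `lam i`. -/
theorem map_rmul (hv : IsStrongEigensystem T v lam) (hT : IsCompactOperator T)
    (hsymm : (T : H →ₗ[ℝ] H).IsSymmetric) (i : ι) (p : Octonion) :
    T (rmul (v i) p) = lam i • rmul (v i) p := by
  refine map_eq_smul_of_forall_inner_eigenvector_eq_zero hT hsymm fun r hr y hy =>
    inner_eq_zero_of_mem_closure_octonionSpan ?_ (hv.mem_closure r y hy)
  rintro _ ⟨j, rfl, rfl⟩ q
  have hji : j ≠ i := fun h => hr (congrArg lam h)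
  exact inner_rmul_rmul_eq_zero (hv.mem_sliceCone j) (hv.mem_sliceCone i)
    (hv.orthonormal.2 j i hji) q p

theorem isWeakAssocOrthonormalBasis (hv : IsStrongEigensystem T v lam) (hT : IsCompactOperator T)
    (hsymm : (T : H →ₗ[ℝ] H).IsSymmetric) : IsWeakAssocOrthonormalBasis v :=
  hv.isWeakAssocOrthonormal.isWeakAssocOrthonormalBasis
    (hv.eq_zero_of_forall_oinner_eq_zero hT hsymm)

theorem hasSum_smul_sliceProj (hv : IsStrongEigensystem T v lam) (hT : IsCompactOperator T)
    (hsymm : (T : H →ₗ[ℝ] H).IsSymmetric) (x : H) :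
    HasSum (fun i => lam i • sliceProj (v i) x) (T x) := by
  have h := hv.isWeakAssocOrthonormal.hasSum_sliceProj
    (hv.eq_zero_of_forall_oinner_eq_zero hT hsymm) x
  simpa only [sliceProj, LinearMap.comp_apply, hv.map_rmul hT hsymm] using h.mapL T

theorem countable_subtype_ne_zero (hv : IsStrongEigensystem T v lam) (hT : IsCompactOperator T) :
    Countable {i // lam i ≠ 0} := by
  have h := (hv.tendsto_cofinite hT).countable_compl_preimage_ker
  rw [ker_nhds] at h
  exact h.to_subtype

theorem hasSum_subtype_ne_zero (hv : IsStrongEigensystem T v lam) (hT : IsCompactOperator T)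
    (hsymm : (T : H →ₗ[ℝ] H).IsSymmetric) (x : H) :
    HasSum (fun i : {i // lam i ≠ 0} => lam i • sliceProj (v i) x) (T x) := by
  refine (Subtype.val_injective.hasSum_iff fun i hi => ?_).2 (hv.hasSum_smul_sliceProj hT hsymm x)
  have h_zero : lam i = 0 := by
    by_contra h_ne
    exact hi ⟨⟨i, h_ne⟩, rfl⟩
  rw [h_zero, zero_smul]

end IsStrongEigensystem

theorem mem_octonionEigenspace_smul_one {T : H →L[ℝ] H} {r : ℝ} {x : H} :
    x ∈ octonionEigenspace T (r • (1 : Octonion)) ↔ T x = r • x := by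
  rw [← rmul_smul_one x r, octonionEigenspace, Set.mem_ofPred_eq]

theorem exists_orthonormal_eigenvectors {T : H →L[ℝ] H} {r : ℝ}
    (hr : IsOctonionEigenvalue T (r • (1 : Octonion)) →
      IsStandardStrongEigenvalue T (r • (1 : Octonion))) :
    ∃ s : Set H, IsOctonionOrthonormal (fun z : s => (z : H)) ∧
      (∀ z ∈ s, z ∈ sliceCone H ∧ T z = r • z) ∧
      ∀ y, T y = r • y → y ∈ closure (octonionSpan s) := by
  by_cases h_eig : IsOctonionEigenvalue T (r • (1 : Octonion))
  · obtain ⟨-, s, h_orthonormal, h_strong, h_closure⟩ := hr h_eig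
    refine ⟨s, h_orthonormal, fun z hz => ?_, fun y hy => h_closure ?_⟩
    · exact ⟨(h_strong z hz).1, mem_octonionEigenspace_smul_one.1 (h_strong z hz).2.2⟩
    · exact mem_octonionEigenspace_smul_one.2 hy
  · refine ⟨∅, ⟨fun i => i.2.elim, fun i => i.2.elim⟩, fun z hz => hz.elim, fun y hy => ?_⟩
    have hy_zero : y = 0 := by
      by_contra hy_ne
      exact h_eig ⟨y, mem_octonionEigenspace_smul_one.2 hy, hy_ne⟩
    exact subset_closure ⟨0, Fin.elim0, Fin.elim0, fun k => k.elim0, by simp [hy_zero]⟩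

theorem exists_isStrongEigensystem {T : H →L[ℝ] H} (hpara : IsParaLinear (T : H →ₗ[ℝ] H))
    (hsymm : (T : H →ₗ[ℝ] H).IsSymmetric)
    (heig : ∀ r : ℝ, IsOctonionEigenvalue T (r • (1 : Octonion)) →
      IsStandardStrongEigenvalue T (r • (1 : Octonion))) :
    ∃ (ι : Type u) (v : ι → H) (lam : ι → ℝ), IsStrongEigensystem T v lam := by
  choose s h_orthonormal h_eigen h_closure using fun r => exists_orthonormal_eigenvectors (heig r)
  have h_cone (i : Σ r, s r) : (i.2 : H) ∈ sliceCone H := (h_eigen i.1 _ i.2.2).1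
  have h_map (i : Σ r, s r) : T i.2 = i.1 • (i.2 : H) := (h_eigen i.1 _ i.2.2).2
  refine ⟨Σ r, s r, fun i => i.2, Sigma.fst, ⟨fun i => (h_orthonormal i.1).1 i.2, ?_⟩, h_cone,
    h_map, fun r y hy => ?_⟩
  · rintro ⟨r, z⟩ ⟨t, w⟩ hzw
    rcases eq_or_ne r t with rfl | hrt
    · exact (h_orthonormal r).2 z w fun h => hzw (congrArg (Sigma.mk r) h)
    · exact hpara.oinner_eq_zero_of_map_eq_smul hsymm (h_cone ⟨r, z⟩) (h_cone ⟨t, w⟩) hrt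
        (h_map ⟨r, z⟩) (h_map ⟨t, w⟩)
  · have h_image : (fun i : Σ r, s r => (i.2 : H)) '' (Sigma.fst ⁻¹' {r}) = s r := by
      ext z
      exact ⟨by rintro ⟨⟨_, z⟩, rfl, rfl⟩; exact z.2, fun hz => ⟨⟨r, z, hz⟩, rfl, rfl⟩⟩
    rw [h_image]
    exact h_closure r y hy

end Hilbert

theorem mainTheorem3 {H : Type u} [NormedAddCommGroup H] [InnerProductSpace ℝ H]
    [CompleteSpace H] [HilbertOctonionBimodule H] (T : H →L[ℝ] H)
    (hpara : IsParaLinear (T : H →ₗ[ℝ] H))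
    (hcompact : IsCompactOperator T)
    (hself : IsOctonionSelfAdjoint T)
    (heig : ∀ r : ℝ, IsOctonionEigenvalue T (r • (1 : Octonion)) →
      IsStandardStrongEigenvalue T (r • (1 : Octonion))) :
    ∃ (ι κ : Type u) (z : ι → H) (w : κ → H) (lam : ι → ℝ),
      IsWeakAssocOrthonormalBasis (Sum.elim z w) ∧
      Countable ι ∧
      (∀ i, lam i ≠ 0 ∧ IsStrongEigenvector T (lam i • (1 : Octonion)) (z i) ∧
        T (z i) = lam i • z i) ∧
      Tendsto lam cofinite (𝓝 0) ∧
      (∀ a, IsStrongEigenvector T 0 (w a) ∧ T (w a) = 0) ∧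
      (∀ i, IsParaLinear (sliceProj (z i)) ∧
        ∀ x, sliceProj (z i) (sliceProj (z i) x) = sliceProj (z i) x) ∧
      ∀ x : H, HasSum (fun i => lam i • sliceProj (z i) x) (T x) := by
  have hsymm := hself.isSymmetric
  obtain ⟨ι, v, lam, hv⟩ := exists_isStrongEigensystem hpara hsymm heig
  have h_sum : Sum.elim (fun i : {j // lam j ≠ 0} => v i) (fun a : {j // ¬lam j ≠ 0} => v a) =
      v ∘ Equiv.sumCompl (lam · ≠ 0) := by
    ext (i | a) <;> rfl
  refine ⟨{j // lam j ≠ 0}, {j // ¬lam j ≠ 0}, fun i => v i, fun a => v a, fun i => lam i, ?_,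
    hv.countable_subtype_ne_zero hcompact, fun i => ⟨i.2, hv.isStrongEigenvector i, hv.map_eq i⟩,
    (hv.tendsto_cofinite hcompact).comp Subtype.val_injective.tendsto_cofinite, fun a => ?_,
    fun i => ⟨isParaLinear_sliceProj (hv.mem_sliceCone i),
      hv.isWeakAssocOrthonormal.sliceProj_sliceProj i⟩,
    hv.hasSum_subtype_ne_zero hcompact hsymm⟩
  · rw [h_sum]
    exact (hv.isWeakAssocOrthonormalBasis hcompact hsymm).comp_equiv _
  · have h_map := hv.map_eq a
    have h_strong := hv.isStrongEigenvector a
    rw [not_not.1 a.2, zero_smul] at h_map h_strong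
    exact ⟨h_strong, h_map⟩
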